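/- Let $k$ be a field, $S=k[z_1,\dots,z_r]$ a polynomial ring with its standard grading, and $S_1$ its space of linear forms. Let $I\subset S$ be a homogeneous ideal, let $n=\dim S/I\ge 0$ be the Krull dimension of $S/I$, and put $e=r-n$. Suppose that there are coordinates $y_1,\dots,y_r$ (a basis of $S_1$) and a monomial order on the monomials in $y_1,\dots,y_r$ such that the initial ideal $\mathrm{in}(I)$, i.e. the ideal generated by the initial terms of all elements of $I$, can be generated by homogeneous polynomials of degree $2$. Then: (1) There are a basis $x_1,\dots,x_{e+n}$ of $S_1$, scalars $c_1,\dots,c_e\in k$ and linear forms $L_{i,j}\in S_1$ ($1\le i\le e$, $i<j\le e+n$) such that the $e$ quadrics $$c_i x_i^2-\bigl(x_{i+1}L_{i,i+1}+\cdots+x_{e+n}L_{i,e+n}\bigr),\qquad i=1,\dots,e,$$ all lie in $I$ and are linearly independent over $k$. (That is, $I$ contains $e$ linearly independent quadratic relations $c_i x_i^2=x_{i+1}L_{i,i+1}+\cdots+x_{e+n}L_{i,e+n}$.) (2) For every integer $m$ with $1\le m\le \operatorname{codim} I$, where $\operatorname{codim} I$ is the height of $I$, the ideal $I$ contains an $m$-dimensional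 $k$-vector space of quadratic forms all of whose elements have rank at most $2(n+m)-1$. Here the rank of a quadratic form over a field of characteristic different from $2$ is the rank of the symmetric matrix representing it; in characteristic $2$, where a quadratic form need not be represented by a symmetric matrix, the rank is the least number of linear forms over $k$ in which it can be written as a polynomial. -/

import Mathlib

attribute [local instance] MvPolynomial.gradedAlgebra

namespace QuadraticInitial

open MvPolynomial

/-- The space `S₁` of linear forms of the polynomial ring `S = k[x₁, …, x_r]`. -/
abbrev LinearForms (k : Type*) [Field k] (r : ℕ) : Submodule k (MvPolynomial (Fin r) k) :=
  homogeneousSubmodule (Fin r) k 1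

/-- The ideal `I` rewritten in the coordinates given by a basis `y` of `S₁`: the polynomials `p`
in formal variables such that `p(y₁, …, y_r)` lies in `I`. -/
noncomputable def inCoordinates {k : Type*} [Field k] {r : ℕ}
    (y : Module.Basis (Fin r) k (LinearForms k r)) (I : Ideal (MvPolynomial (Fin r) k)) :
    Ideal (MvPolynomial (Fin r) k) :=
  I.comap (aeval (fun i => (y i : MvPolynomial (Fin r) k)))

/-- The initial ideal: the ideal generated by the initial terms of all elements of `J`. -/
noncomputable def initialIdeal {k : Type*} [Field k] {r : ℕ} (ord : MonomialOrder (Fin r))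
    (J : Ideal (MvPolynomial (Fin r) k)) : Ideal (MvPolynomial (Fin r) k) :=
  Ideal.span {t | ∃ p ∈ J, t = ord.leadingTerm p}

/-- The ideal `J` can be generated by homogeneous polynomials of degree 2. -/
def IsGeneratedByQuadrics {k : Type*} [Field k] {r : ℕ}
    (J : Ideal (MvPolynomial (Fin r) k)) : Prop :=
  ∃ G : Set (MvPolynomial (Fin r) k), (∀ g ∈ G, g.IsHomogeneous 2) ∧ J = Ideal.span G

/-- `Q` is a quadratic form of rank at most `N`. In characteristic different from 2 the rank is
that of the symmetric matrix representing `Q`. In characteristic 2, where a quadratic form need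
not be represented by a symmetric matrix, the rank is the least number of linear forms in which
`Q` can be written as a polynomial. -/
def IsQuadricOfRankLE {k : Type*} [Field k] {r : ℕ} (Q : MvPolynomial (Fin r) k) (N : ℕ) : Prop :=
  Q.IsHomogeneous 2 ∧
  ((2 : k) ≠ 0 → ∃ A : Matrix (Fin r) (Fin r) k, A.IsSymm ∧
    Q = ∑ i, ∑ j, C (A i j) * X i * X j ∧ A.rank ≤ N) ∧
  ((2 : k) = 0 → ∃ l : Fin N → MvPolynomial (Fin r) k, (∀ i, l i ∈ LinearForms k r) ∧
    Q ∈ Algebra.adjoin k (Set.range l))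

/-- The quadric `c x_i² - ∑_{j > i} x_j L_j`, which vanishes modulo an ideal exactly when the
relation `c x_i² = x_{i+1} L_{i+1} + ⋯ + x_r L_r` holds there. -/
noncomputable def flagQuadric {k : Type*} [Field k] {r : ℕ}
    (x : Module.Basis (Fin r) k (LinearForms k r)) (i : Fin r) (c : k)
    (L : Fin r → LinearForms k r) : MvPolynomial (Fin r) k :=
  C c * (x i : MvPolynomial (Fin r) k) ^ 2 -
    ∑ j ∈ Finset.Ioi i, (x j : MvPolynomial (Fin r) k) * (L j : MvPolynomial (Fin r) k)

end QuadraticInitial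

/-!
Write `J` for `I` in the coordinates `y`. Let `D` be the set of *pivots*: the indices `i` such that
some quadric in `J` has leading monomial `X_i X_j` with `X_j ≤ X_i` in the monomial order.

Since the initial ideal is generated by quadrics, the leading monomial of any nonzero `p ∈ J` is
divisible by the leading monomial of a quadric in `J`, so `p` involves a variable indexed by `D`
(`exists_isPivotQuadric_of_mem`). Hence the polynomial ring in the variables outside `D` embeds in
`S/I`, and comparing dimensions gives `|Dᶜ| ≤ n`, that is `|D| ≥ e` (`card_compl_le_ringKrullDim`,
which rests on Noether normalization and going up).

A monomial of degree 2 that is at most `X_i X_j`, where `X_j ≤ X_i`, either is `X_i ^ 2` or involves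
a variable smaller than `X_i` (`IsPivotQuadric.eq_or_lt`). So, once the variables are listed with
those in `D` first and in decreasing order, a quadric whose pivot is at position `t < e` has the
form `c x_t² - ∑_{j > t} x_j L_j`. Different pivots give different leading monomials, hence linear
independence.

For the rank bound, the span of the last `m` of these `e` quadrics consists of quadrics
`c x_s² - ∑_{j > s} x_j L_j` with `s` the `m`-th position from the end of the first `e`. There are
`n + m - 1` positions after `s`, so the rank is at most `2 (n + m - 1) + 1`. That `m ≤ e` holds
for `m` at most the height of `I` is `height_add_ringKrullDim_quotient_le`.
-/

namespace QuadraticInitial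

open MvPolynomial

/-! ### Dimension and height -/

/-- Chains of primes of `A` lift to `B` by lying over and going up. -/
theorem ringKrullDim_le_of_injective_of_isIntegral {A B : Type*} [CommRing A] [CommRing B]
    (g : A →+* B) (hinj : Function.Injective g) (hint : g.IsIntegral) :
    ringKrullDim A ≤ ringKrullDim B := by
  algebraize [g]
  have : Algebra.IsIntegral A B := ⟨hint⟩
  refine iSup_le fun l => ?_
  obtain ⟨P, -, hP, hPl⟩ := Ideal.exists_ideal_over_prime_of_isIntegral (S := B) l.head.asIdeal ⊥
    ((Ideal.comap_bot_of_injective (algebraMap A B) hinj).trans_le bot_le)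
  have : P.LiesOver l.head.asIdeal := ⟨hPl.symm⟩
  obtain ⟨L, hL, -⟩ := Ideal.exists_ltSeries_of_hasGoingUp l P
  rw [← hL]
  exact Order.LTSeries.length_le_krullDim L

/-- A finitely generated `k`-algebra containing a polynomial ring in `d` variables has dimension at
least `d`. The algebra need not be a domain: some prime contracts to zero in the polynomial ring,
and modulo that prime the transcendence degree is the number of variables of a Noether
normalization. -/
theorem natCard_le_ringKrullDim_of_injective {k A ι : Type*} [Field k] [CommRing A] [Algebra k A]
    [Algebra.FiniteType k A] [Finite ι] (f : MvPolynomial ι k →ₐ[k] A)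
    (hf : Function.Injective f) : (Nat.card ι : WithBot ℕ∞) ≤ ringKrullDim A := by
  have hbot : (⊥ : Ideal (MvPolynomial ι k)) ∈ minimalPrimes (MvPolynomial ι k) := by
    rw [IsDomain.minimalPrimes_eq_singleton_bot]; rfl
  obtain ⟨P, hP, hcomap⟩ :=
    Ideal.exists_comap_eq_of_mem_minimalPrimes_of_injective (f := f.toRingHom) hf ⊥ hbot
  have hfP : Function.Injective ((Ideal.Quotient.mkₐ k P).comp f) := by
    rw [injective_iff_map_eq_zero]
    intro p hp
    have : f p ∈ P := Ideal.Quotient.eq_zero_iff_mem.mp hp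
    change p ∈ P.comap f.toRingHom at this
    rwa [hcomap] at this
  obtain ⟨s, g, hg, hgint⟩ := exists_integral_inj_algHom_of_fg k (A ⧸ P)
  have hdim : (s : WithBot ℕ∞) ≤ ringKrullDim A := by
    calc (s : WithBot ℕ∞) = ringKrullDim (MvPolynomial (Fin s) k) := by
          rw [MvPolynomial.ringKrullDim_of_isNoetherianRing, ringKrullDim_eq_zero_of_field]
          simp
      _ ≤ ringKrullDim (A ⧸ P) := ringKrullDim_le_of_injective_of_isIntegral g.toRingHom hg hgint
      _ ≤ ringKrullDim A := ringKrullDim_quotient_le P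
  refine le_trans ?_ hdim
  have hcard : Nat.card ι ≤ s := by
    have hind : AlgebraicIndependent k fun i => (Ideal.Quotient.mkₐ k P).comp f (X i) := by
      rw [AlgebraicIndependent]
      convert! hfP
      ext; simp
    have halg : Algebra.IsAlgebraic (Algebra.adjoin k (Set.range fun i => g (X i))) (A ⧸ P) := by
      have hmem (p : MvPolynomial (Fin s) k) :
          g p ∈ Algebra.adjoin k (Set.range fun i => g (X i)) := by
        rw [Algebra.adjoin_range_eq_range_aeval]
        exact ⟨p, (DFunLike.congr_fun (aeval_unique g) p).symm⟩
      have : (algebraMap (Algebra.adjoin k (Set.range fun i => g (X i))) (A ⧸ P)).IsIntegral :=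
        RingHom.IsIntegral.tower_top (g.codRestrict _ hmem).toRingHom _ hgint
      have : Algebra.IsIntegral (Algebra.adjoin k (Set.range fun i => g (X i))) (A ⧸ P) := ⟨this⟩
      exact Algebra.IsIntegral.isAlgebraic
    have hle := hind.lift_cardinalMk_le_trdeg.trans
      (Cardinal.lift_le.mpr
        (Algebra.IsAlgebraic.trdeg_le_cardinalMk k (Set.range fun i => g (X i))))
    have hfin : Cardinal.mk (Set.range fun i => g (X i)) ≤ s := by
      simpa using Cardinal.mk_range_le_lift (f := fun i => g (X i))
    have hle' := hle.trans (Cardinal.lift_le.mpr hfin)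
    rw [← Nat.cast_card] at hle'
    simpa using hle'
  exact_mod_cast hcard

theorem height_add_ringKrullDim_quotient_le {R : Type*} [CommRing R] (I : Ideal R) :
    (I.height : WithBot ℕ∞) + ringKrullDim (R ⧸ I) ≤ ringKrullDim R := by
  by_cases hI : I = ⊤
  · subst hI
    have : ringKrullDim (R ⧸ (⊤ : Ideal R)) = ⊥ := by
      have : Subsingleton (R ⧸ (⊤ : Ideal R)) := Ideal.Quotient.subsingleton_iff.mpr rfl
      exact ringKrullDim_eq_bot_of_subsingleton
    simp [this]
  have : Nonempty (PrimeSpectrum.zeroLocus (R := R) I) := by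
    obtain ⟨M, hM, hle⟩ := Ideal.exists_le_maximal I hI
    exact ⟨⟨⟨M, hM.isPrime⟩, hle⟩⟩
  have : Nonempty (PrimeSpectrum R) := this.map Subtype.val
  rw [ringKrullDim_quotient, Order.krullDim_eq_iSup_coheight_of_nonempty, ringKrullDim,
    Order.krullDim_eq_iSup_height_add_coheight_of_nonempty, ← WithBot.coe_add, WithBot.coe_le_coe,
    ENat.add_iSup]
  refine iSup_le fun P => le_iSup_of_le (P : PrimeSpectrum R) (add_le_add ?_ ?_)
  · rw [← PrimeSpectrum.height_eq_orderHeight]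
    exact Ideal.height_mono P.2
  · exact Order.coheight_le_coheight_apply_of_strictMono Subtype.val (fun _ _ h => h) P

/-! ### Flag quadrics and their rank -/

section FlagSpace

variable {k : Type*} [Field k] {r : ℕ}

/-- The space of all quadrics `c x_i² - ∑_{j > i} x_j L_j`, for a fixed basis `x` of the linear
forms and a fixed index `i`, with `c` and the `L_j` varying. -/
def flagSpace (x : Module.Basis (Fin r) k (LinearForms k r)) (i : Fin r) :
    Submodule k (MvPolynomial (Fin r) k) where
  carrier := {Q | ∃ (c : k) (L : Fin r → LinearForms k r), Q = flagQuadric x i c L}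
  zero_mem' := ⟨0, 0, by simp [flagQuadric]⟩
  add_mem' := by
    rintro _ _ ⟨c, L, rfl⟩ ⟨c', L', rfl⟩
    refine ⟨c + c', L + L', ?_⟩
    simp only [flagQuadric, map_add, Pi.add_apply, Submodule.coe_add, mul_add,
      Finset.sum_add_distrib]
    ring
  smul_mem' := by
    rintro a _ ⟨c, L, rfl⟩
    refine ⟨a * c, a • L, ?_⟩
    simp only [flagQuadric, map_mul, Pi.smul_apply, Submodule.coe_smul, smul_eq_C_mul, mul_sub,
      Finset.mul_sum, mul_assoc, mul_left_comm (C a)]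

variable (x : Module.Basis (Fin r) k (LinearForms k r))

theorem sq_mem_flagSpace (i : Fin r) :
    (x i : MvPolynomial (Fin r) k) * x i ∈ flagSpace x i :=
  ⟨1, 0, by simp [flagQuadric, sq]⟩

theorem mul_mem_flagSpace {i j : Fin r} (hij : i < j) (l : LinearForms k r) :
    (x j : MvPolynomial (Fin r) k) * l ∈ flagSpace x i := by
  refine ⟨0, Pi.single j (-l), ?_⟩
  rw [flagQuadric, Finset.sum_eq_single_of_mem j (Finset.mem_Ioi.mpr hij)]
  · simp
  · intro b _ hb
    simp [hb]

theorem flagSpace_antitone : Antitone (flagSpace x) := by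
  rintro i j hij _ ⟨c, L, rfl⟩
  refine sub_mem ?_ (sum_mem fun l hl =>
    mul_mem_flagSpace x (hij.trans_lt (Finset.mem_Ioi.mp hl)) (L l))
  rw [← smul_eq_C_mul, sq]
  refine Submodule.smul_mem _ c ?_
  rcases hij.eq_or_lt with rfl | h
  · exact sq_mem_flagSpace x i
  · exact mul_mem_flagSpace x h (x j)

theorem isHomogeneous_of_mem_flagSpace {i : Fin r} {Q : MvPolynomial (Fin r) k}
    (hQ : Q ∈ flagSpace x i) : Q.IsHomogeneous 2 := by
  obtain ⟨c, L, rfl⟩ := hQ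
  refine IsHomogeneous.sub (IsHomogeneous.C_mul ?_ c) (IsHomogeneous.sum _ _ _ fun j _ => ?_)
  · exact IsHomogeneous.pow (x i).2 2
  · exact IsHomogeneous.mul (x j).2 (L j).2

end FlagSpace

section Rank

variable {k σ : Type*} [Field k] [Fintype σ]

/-- The quadratic form `∑ A i j X_i X_j` represented by a square matrix `A`, symmetric or not. -/
noncomputable def toQuadric : Matrix σ σ k →ₗ[k] MvPolynomial σ k where
  toFun A := ∑ i, ∑ j, C (A i j) * X i * X j
  map_add' A B := by
    simp only [Matrix.add_apply, map_add, add_mul, Finset.sum_add_distrib]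
  map_smul' a A := by
    simp only [Matrix.smul_apply, smul_eq_mul, map_mul, smul_eq_C_mul, Finset.mul_sum, mul_assoc,
      RingHom.id_apply]

theorem toQuadric_apply (A : Matrix σ σ k) :
    toQuadric A = ∑ i, ∑ j, C (A i j) * X i * X j := rfl

theorem toQuadric_vecMulVec (v w : σ → k) :
    toQuadric (Matrix.vecMulVec v w) =
      (∑ i, C (v i) * X i) * ∑ j, C (w j) * X j := by
  rw [toQuadric_apply, Finset.sum_mul_sum]
  refine Finset.sum_congr rfl fun i _ => Finset.sum_congr rfl fun j _ => ?_
  rw [Matrix.vecMulVec_apply, map_mul]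
  ring

theorem rank_add_le_rank_add_rank (A B : Matrix σ σ k) : (A + B).rank ≤ A.rank + B.rank := by
  rw [Matrix.rank, Matrix.rank, Matrix.rank, Matrix.mulVecLin_add]
  refine le_trans (Submodule.finrank_mono ?_) (Submodule.finrank_add_le_finrank_add_finrank _ _)
  rintro _ ⟨v, rfl⟩
  exact Submodule.add_mem_sup ⟨v, rfl⟩ ⟨v, rfl⟩

/-- `Q` is represented by a symmetric matrix of rank at most `N`. In characteristic 2 this is
more restrictive than being a quadratic form in `N` linear forms. -/
def HasSymmetricRankLE (Q : MvPolynomial σ k) (N : ℕ) : Prop :=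
  ∃ A : Matrix σ σ k, A.IsSymm ∧ Q = toQuadric A ∧ A.rank ≤ N

namespace HasSymmetricRankLE

theorem zero : HasSymmetricRankLE (0 : MvPolynomial σ k) 0 :=
  ⟨0, Matrix.isSymm_zero, by simp, by simp⟩

theorem add {Q Q' : MvPolynomial σ k} {N N' : ℕ} (h : HasSymmetricRankLE Q N)
    (h' : HasSymmetricRankLE Q' N') : HasSymmetricRankLE (Q + Q') (N + N') := by
  obtain ⟨A, hA, rfl, hN⟩ := h
  obtain ⟨B, hB, rfl, hN'⟩ := h'
  exact ⟨A + B, hA.add hB, (map_add _ _ _).symm,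
    (rank_add_le_rank_add_rank A B).trans (add_le_add hN hN')⟩

theorem smul {Q : MvPolynomial σ k} {N : ℕ} (a : k) (h : HasSymmetricRankLE Q N) :
    HasSymmetricRankLE (a • Q) N := by
  obtain ⟨A, hA, rfl, hN⟩ := h
  refine ⟨a • A, hA.smul a, (map_smul _ _ _).symm, le_trans ?_ hN⟩
  classical
  rw [← one_mul A, ← smul_mul_assoc, one_mul]
  exact Matrix.rank_mul_le_right _ A

theorem sum {ι : Type*} (s : Finset ι) {Q : ι → MvPolynomial σ k} {N : ℕ}
    (h : ∀ i ∈ s, HasSymmetricRankLE (Q i) N) : HasSymmetricRankLE (∑ i ∈ s, Q i) (s.card * N) := by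
  classical
  induction s using Finset.induction_on with
  | empty => simpa using zero
  | insert a s ha ih =>
    rw [Finset.sum_insert ha, Finset.card_insert_of_notMem ha, add_one_mul, add_comm _ N]
    exact (h a (s.mem_insert_self a)).add (ih fun i hi => h i (Finset.mem_insert_of_mem hi))

theorem mono {Q : MvPolynomial σ k} {N N' : ℕ} (h : HasSymmetricRankLE Q N) (hN : N ≤ N') :
    HasSymmetricRankLE Q N' := by
  obtain ⟨A, hA, hQ, hr⟩ := h
  exact ⟨A, hA, hQ, hr.trans hN⟩

end HasSymmetricRankLE

theorem eq_sum_C_mul_X_of_isHomogeneous_one {l : MvPolynomial σ k} (hl : l.IsHomogeneous 1) :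
    ∃ v : σ → k, l = ∑ i, C (v i) * X i := by
  rw [← mem_homogeneousSubmodule, homogeneousSubmodule_one_eq_span_X,
    Submodule.mem_span_range_iff_exists_fun] at hl
  obtain ⟨v, rfl⟩ := hl
  exact ⟨v, by simp only [smul_eq_C_mul]⟩

theorem hasSymmetricRankLE_sq {l : MvPolynomial σ k} (hl : l.IsHomogeneous 1) :
    HasSymmetricRankLE (l ^ 2) 1 := by
  obtain ⟨v, rfl⟩ := eq_sum_C_mul_X_of_isHomogeneous_one hl
  exact ⟨Matrix.vecMulVec v v, Matrix.transpose_vecMulVec v v, by rw [toQuadric_vecMulVec, sq],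
    Matrix.rank_vecMulVec_le v v⟩

theorem hasSymmetricRankLE_mul (h2 : (2 : k) ≠ 0) {l l' : MvPolynomial σ k}
    (hl : l.IsHomogeneous 1) (hl' : l'.IsHomogeneous 1) : HasSymmetricRankLE (l * l') 2 := by
  obtain ⟨v, rfl⟩ := eq_sum_C_mul_X_of_isHomogeneous_one hl
  obtain ⟨w, rfl⟩ := eq_sum_C_mul_X_of_isHomogeneous_one hl'
  -- `2 l l'` is represented by the symmetrization of the rank one matrix of `l l'`.
  have h : HasSymmetricRankLE ((2 : k) • ((∑ i, C (v i) * X i) * ∑ i, C (w i) * X i)) 2 := by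
    refine ⟨Matrix.vecMulVec v w + Matrix.vecMulVec w v, ?_, ?_, ?_⟩
    · rw [Matrix.IsSymm, Matrix.transpose_add, Matrix.transpose_vecMulVec,
        Matrix.transpose_vecMulVec, add_comm]
    · rw [map_add, toQuadric_vecMulVec, toQuadric_vecMulVec, two_smul]
      ring
    · exact (rank_add_le_rank_add_rank _ _).trans
        (add_le_add (Matrix.rank_vecMulVec_le v w) (Matrix.rank_vecMulVec_le w v))
  simpa [smul_smul, h2] using h.smul (2 : k)⁻¹

end Rank

/-- A quadric in `flagSpace x i` is a multiple of a square plus `r - 1 - i` products of two linear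
forms, with ranks 1 and at most 2; it is a polynomial in the linear forms occurring there. -/
theorem isQuadricOfRankLE_of_mem_flagSpace {k : Type*} [Field k] {r : ℕ}
    (x : Module.Basis (Fin r) k (LinearForms k r)) {i : Fin r} {Q : MvPolynomial (Fin r) k}
    (hQ : Q ∈ flagSpace x i) {N : ℕ} (hN : 2 * (r - 1 - i) + 1 ≤ N) : IsQuadricOfRankLE Q N := by
  classical
  refine ⟨isHomogeneous_of_mem_flagSpace x hQ, fun h2 => ?_, fun _ => ?_⟩
  · obtain ⟨c, L, rfl⟩ := hQ
    change HasSymmetricRankLE _ N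
    have hsq := (hasSymmetricRankLE_sq (x i).2).smul c
    have hsum := HasSymmetricRankLE.sum (Finset.Ioi i) fun j _ =>
      hasSymmetricRankLE_mul h2 (x j).2 (L j).2
    have := (hsq.add (hsum.smul (-1))).mono (N' := N) (by rw [Fin.card_Ioi]; omega)
    rwa [smul_eq_C_mul, neg_one_smul, ← sub_eq_add_neg] at this
  · obtain ⟨c, L, rfl⟩ := hQ
    set T : Finset (MvPolynomial (Fin r) k) :=
      {(x i : MvPolynomial (Fin r) k)} ∪ ((Finset.Ioi i).image (fun j => (x j).1) ∪
        (Finset.Ioi i).image fun j => (L j).1) with hT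
    have hcard : T.card ≤ N := by
      refine le_trans (Finset.card_union_le _ _) (le_trans (add_le_add_right
        ((Finset.card_union_le _ _).trans
          (add_le_add Finset.card_image_le Finset.card_image_le)) _) ?_)
      rw [Fin.card_Ioi, Finset.card_singleton]
      omega
    have hlin : ∀ l ∈ T, l ∈ LinearForms k r := by
      intro l hl
      simp only [hT, Finset.mem_union, Finset.mem_singleton, Finset.mem_image] at hl
      rcases hl with rfl | ⟨j, -, rfl⟩ | ⟨j, -, rfl⟩
      exacts [(x i).2, (x j).2, (L j).2]
    -- List the elements of `T`, padding with zero up to length `N`.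
    refine ⟨fun a => if h : a < T.card then T.equivFin.symm ⟨a, h⟩ else 0, fun a => ?_, ?_⟩
    · dsimp only
      split_ifs with h
      · exact hlin _ (T.equivFin.symm ⟨a, h⟩).2
      · exact zero_mem _
    · have hsub : ∀ l ∈ T, l ∈ Algebra.adjoin k (Set.range fun a : Fin N =>
          if h : a < T.card then (T.equivFin.symm ⟨a, h⟩ : MvPolynomial (Fin r) k) else 0) := by
        intro l hl
        refine Algebra.subset_adjoin
          ⟨⟨T.equivFin ⟨l, hl⟩, (T.equivFin ⟨l, hl⟩).2.trans_le hcard⟩, ?_⟩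
        simp
      refine sub_mem (mul_mem (Subalgebra.algebraMap_mem _ c) (pow_mem (hsub _ ?_) 2))
        (sum_mem fun j hj => mul_mem (hsub _ ?_) (hsub _ ?_))
      · simp [hT]
      · exact Finset.mem_union_right _ (Finset.mem_union_left _ (Finset.mem_image_of_mem _ hj))
      · exact Finset.mem_union_right _ (Finset.mem_union_right _ (Finset.mem_image_of_mem _ hj))

/-! ### Leading monomials and pivots -/

section Leading

variable {k σ : Type*} [Field k] (ord : MonomialOrder σ) {J : Ideal (MvPolynomial σ k)}

/-- Every monomial of an element of the initial ideal of `J` is itself the leading monomial of an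
element of `J`. -/
theorem exists_mem_degree_eq_of_mem_support {g : MvPolynomial σ k}
    (hg : g ∈ Ideal.span {t | ∃ p ∈ J, t = ord.leadingTerm p}) {d : σ →₀ ℕ} (hd : d ∈ g.support) :
    ∃ p ∈ J, p ≠ 0 ∧ ord.degree p = d := by
  have hset : {t | ∃ p ∈ J, t = ord.leadingTerm p} =
      ord.leadingTerm '' (J : Set (MvPolynomial σ k)) := by
    ext t; simp [eq_comm]
  rw [hset, MonomialOrder.span_leadingTerm_eq_span_monomial',
    ← Set.image_image (fun s => monomial s (1 : k)) ord.degree, mem_ideal_span_monomial_image] at hg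
  obtain ⟨_, ⟨p, ⟨hpJ, hp0⟩, rfl⟩, hle⟩ := hg d hd
  have hp0 : p ≠ 0 := hp0
  -- Divisibility of monomials is the order on exponents; multiply `p` up to the exponent `d`.
  have hm : (monomial (d - ord.degree p) (1 : k)) ≠ 0 := by simp
  refine ⟨monomial (d - ord.degree p) 1 * p, J.mul_mem_left _ hpJ, mul_ne_zero hm hp0, ?_⟩
  classical
  rw [ord.degree_mul hm hp0, ord.degree_monomial, if_neg one_ne_zero, tsub_add_cancel_of_le hle]

/-- Passing to the homogeneous component that contains the leading monomial keeps the leading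
monomial. -/
theorem degree_homogeneousComponent {p : MvPolynomial σ k} (hp : p ≠ 0) {n : ℕ}
    (hn : (ord.degree p).degree = n) :
    homogeneousComponent n p ≠ 0 ∧ ord.degree (homogeneousComponent n p) = ord.degree p := by
  have hmem : ord.degree p ∈ (homogeneousComponent n p).support := by
    rw [mem_support_iff, coeff_homogeneousComponent, if_pos hn]
    exact mem_support_iff.mp (ord.degree_mem_support hp)
  refine ⟨fun h => by simp [h] at hmem, ?_⟩
  refine ord.toSyn.injective (le_antisymm ?_ (ord.le_degree hmem))
  refine ord.degree_le_iff.mpr fun d hd => ord.le_degree ?_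
  rw [mem_support_iff, coeff_homogeneousComponent] at hd
  exact mem_support_iff.mpr fun h => hd (by simp [h])

theorem linearIndependent_of_injective_degree {ι : Type*} {Q : ι → MvPolynomial σ k}
    (h0 : ∀ i, Q i ≠ 0) (hinj : Function.Injective fun i => ord.degree (Q i)) :
    LinearIndependent k Q := by
  classical
  rw [linearIndependent_iff']
  intro s a hsum
  by_contra! hne
  obtain ⟨i, his, hi⟩ := hne
  -- The coefficient of the largest leading monomial comes from a single term.
  obtain ⟨t, ht, hmax⟩ := (s.filter fun i => a i ≠ 0).exists_max_image
    (fun i => ord.toSyn (ord.degree (Q i))) ⟨i, Finset.mem_filter.mpr ⟨his, hi⟩⟩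
  rw [Finset.mem_filter] at ht
  have := congrArg (coeff (ord.degree (Q t))) hsum
  rw [coeff_sum, Finset.sum_eq_single_of_mem t ht.1, coeff_smul, coeff_zero, smul_eq_mul] at this
  · exact mul_ne_zero ht.2 (mem_support_iff.mp (ord.degree_mem_support (h0 t))) this
  · intro j hj hjt
    by_cases haj : a j = 0
    · simp [haj]
    · have hlt := lt_of_le_of_ne (hmax j (Finset.mem_filter.mpr ⟨hj, haj⟩))
        fun h => hjt (hinj (ord.toSyn.injective h))
      rw [coeff_smul, ord.coeff_eq_zero_of_lt hlt, smul_zero]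

end Leading

theorem exists_single_add_single_of_degree_eq_two {σ : Type*} {d : σ →₀ ℕ} (hd : d.degree = 2) :
    ∃ a b, d = Finsupp.single a 1 + Finsupp.single b 1 := by
  obtain ⟨a, ha⟩ : ∃ a, d a ≠ 0 := by
    by_contra! h
    have : d = 0 := Finsupp.ext h
    simp [this] at hd
  have hle : Finsupp.single a 1 ≤ d := by
    rw [Finsupp.single_le_iff]; omega
  have h1 : (d - Finsupp.single a 1).degree = 1 := by
    have := congrArg Finsupp.degree (add_tsub_cancel_of_le hle)
    rw [map_add, Finsupp.degree_single] at this
    omega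
  have h1' : d - Finsupp.single a 1 ∈ Set.range fun b : σ => Finsupp.single b 1 := by
    rw [Finsupp.range_single_one]; exact h1
  obtain ⟨b, hb⟩ := h1'
  exact ⟨a, b, by rw [show Finsupp.single b 1 = _ from hb, add_tsub_cancel_of_le hle]⟩

section Pivot

variable {k : Type*} [Field k] {σ : Type*} (ord : MonomialOrder σ) (J : Ideal (MvPolynomial σ k))

/-- `Q` is a nonzero quadric of `J` whose leading monomial is `X_i X_j` with `X_j ≤ X_i` in the
monomial order (possibly `j = i`). The pivot `i` is thus the larger variable of the leading
monomial. -/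
structure IsPivotQuadric (i : σ) (Q : MvPolynomial σ k) : Prop where
  mem : Q ∈ J
  ne_zero : Q ≠ 0
  isHomogeneous : Q.IsHomogeneous 2
  exists_degree_eq : ∃ j, ord.toSyn (Finsupp.single j 1) ≤ ord.toSyn (Finsupp.single i 1) ∧
    ord.degree Q = Finsupp.single i 1 + Finsupp.single j 1

variable {ord J}

/-- If the initial ideal of `J` is generated by quadrics, every nonzero element of `J` involves the
pivot variable of some quadric of `J`. -/
theorem exists_isPivotQuadric_of_mem (hJ : ∀ p ∈ J, homogeneousComponent 2 p ∈ J)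
    {G : Set (MvPolynomial σ k)} (hG : ∀ g ∈ G, g.IsHomogeneous 2)
    (hspan : Ideal.span {t | ∃ p ∈ J, t = ord.leadingTerm p} = Ideal.span G)
    {p : MvPolynomial σ k} (hp : p ∈ J) (hp0 : p ≠ 0) :
    ∃ i ∈ p.vars, ∃ Q, IsPivotQuadric ord J i Q := by
  have hlead : ord.leadingTerm p ∈ Ideal.span G := hspan ▸ Ideal.subset_span ⟨p, hp, rfl⟩
  have hle : Ideal.span G ≤
      Ideal.span ((fun s => monomial s (1 : k)) '' {d | ∃ g ∈ G, d ∈ g.support}) := by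
    rw [Ideal.span_le]
    intro g hg
    exact mem_ideal_span_monomial_image.mpr fun d hd => ⟨d, ⟨g, hg, hd⟩, le_rfl⟩
  obtain ⟨d, ⟨g, hg, hd⟩, hdle⟩ := mem_ideal_span_monomial_image.mp (hle hlead) (ord.degree p)
    (by rw [ord.support_leadingTerm' hp0]; simp)
  have hd2 : d.degree = 2 := (hG g hg).degree_eq_sum_deg_support hd |>.symm
  obtain ⟨q, hq, hq0, hqd⟩ :=
    exists_mem_degree_eq_of_mem_support ord (hspan ▸ Ideal.subset_span hg) hd
  obtain ⟨hQ0, hQd⟩ := degree_homogeneousComponent ord hq0 (hqd ▸ hd2)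
  rw [hqd] at hQd
  have hvars (a : σ) (ha : d a ≠ 0) : a ∈ p.vars :=
    (mem_vars_iff_mem_support a).mpr ⟨ord.degree p, ord.degree_mem_support hp0, by
      rw [Finsupp.mem_support_iff]; have := hdle a; omega⟩
  obtain ⟨a, b, hab⟩ := exists_single_add_single_of_degree_eq_two hd2
  rcases le_total (ord.toSyn (Finsupp.single b 1)) (ord.toSyn (Finsupp.single a 1)) with h | h
  · exact ⟨a, hvars a (by simp [hab]), _, hJ q hq, hQ0, homogeneousComponent_isHomogeneous 2 q,
      b, h, hQd.trans hab⟩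
  · exact ⟨b, hvars b (by simp [hab]), _, hJ q hq, hQ0, homogeneousComponent_isHomogeneous 2 q,
      a, h, hQd.trans (hab.trans (add_comm _ _))⟩

/-- A product of two variables that are both at least the pivot `X_i` is at least `X_i ^ 2`, so it
can only occur in a quadric with pivot `i` if it equals `X_i ^ 2`. -/
theorem IsPivotQuadric.eq_or_lt {i : σ} {Q : MvPolynomial σ k} (hQ : IsPivotQuadric ord J i Q)
    {a b : σ} (hab : Finsupp.single a 1 + Finsupp.single b 1 ∈ Q.support) :
    (a = i ∧ b = i) ∨ ord.toSyn (Finsupp.single a 1) < ord.toSyn (Finsupp.single i 1) ∨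
      ord.toSyn (Finsupp.single b 1) < ord.toSyn (Finsupp.single i 1) := by
  by_contra! h
  obtain ⟨hne, ha, hb⟩ := h
  obtain ⟨j, hj, hdeg⟩ := hQ.exists_degree_eq
  have hle := ord.le_degree hab
  rw [hdeg, map_add, map_add] at hle
  have hinj : Function.Injective fun a : σ => ord.toSyn (Finsupp.single a 1) :=
    ord.toSyn.injective.comp (Finsupp.single_left_injective one_ne_zero)
  have hai : a = i := hinj (le_antisymm
    (le_of_add_le_add_right (hle.trans (add_le_add_right (hj.trans hb) _))) ha)
  subst hai
  exact hne rfl (hinj (le_antisymm ((le_of_add_le_add_left hle).trans hj) hb))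

theorem IsPivotQuadric.eq_of_degree_eq {i i' : σ} {Q Q' : MvPolynomial σ k}
    (hQ : IsPivotQuadric ord J i Q) (hQ' : IsPivotQuadric ord J i' Q')
    (h : ord.degree Q = ord.degree Q') : i = i' := by
  have key {i i' : σ} {Q Q' : MvPolynomial σ k} (hQ : IsPivotQuadric ord J i Q)
      (hQ' : IsPivotQuadric ord J i' Q') (h : ord.degree Q = ord.degree Q') :
      ord.toSyn (Finsupp.single i 1) ≤ ord.toSyn (Finsupp.single i' 1) := by
    classical
    obtain ⟨j, -, hd⟩ := hQ.exists_degree_eq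
    obtain ⟨j', hj', hd'⟩ := hQ'.exists_degree_eq
    have hi : (Finsupp.single i' 1 + Finsupp.single j' 1 : σ →₀ ℕ) i ≠ 0 := by
      rw [← hd', ← h, hd]; simp
    rcases eq_or_ne i i' with rfl | hii'
    · exact le_rfl
    · rcases eq_or_ne i j' with rfl | hij'
      · exact hj'
      · simp [hii'.symm, hij'.symm] at hi
  exact Finsupp.single_left_injective one_ne_zero
    (ord.toSyn.injective (le_antisymm (key hQ hQ' h) (key hQ' hQ h.symm)))

theorem linearIndependent_of_isPivotQuadric {ι : Type*} {i : ι → σ} (hi : Function.Injective i)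
    {Q : ι → MvPolynomial σ k} (hQ : ∀ t, IsPivotQuadric ord J (i t) (Q t)) :
    LinearIndependent k Q :=
  linearIndependent_of_injective_degree ord (fun t => (hQ t).ne_zero)
    fun a b hab => hi ((hQ a).eq_of_degree_eq (hQ b) hab)

end Pivot

/-! ### Coordinates and the ordering of the variables -/

section Coordinates

variable {k : Type*} [Field k] {r : ℕ} (y : Module.Basis (Fin r) k (LinearForms k r))

/-- The substitution `X_i ↦ y_i`, an endomorphism of the polynomial ring. -/
noncomputable abbrev coordinateMap : MvPolynomial (Fin r) k →ₐ[k] MvPolynomial (Fin r) k :=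
  aeval fun i => (y i : MvPolynomial (Fin r) k)

theorem coordinateMap_injective : Function.Injective (coordinateMap y) := by
  -- The inverse substitution sends a linear form to its coordinates with respect to `y`.
  let X' : Fin r → LinearForms k r := fun i => ⟨X i, isHomogeneous_X k i⟩
  let ψ : MvPolynomial (Fin r) k →ₐ[k] MvPolynomial (Fin r) k := aeval fun i => y.constr k X (X' i)
  have hψ (l : LinearForms k r) : ψ l = y.constr k X l := by
    obtain ⟨v, hv⟩ := eq_sum_C_mul_X_of_isHomogeneous_one l.2
    have hl : l = ∑ i, v i • X' i := by
      ext1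
      simp [hv, X', smul_eq_C_mul]
    rw [hl]
    simp [ψ, X']
  have hid : ψ.comp (coordinateMap y) = AlgHom.id k _ := by
    ext1 i
    rw [AlgHom.comp_apply, aeval_X, hψ, Module.Basis.constr_basis, AlgHom.id_apply]
  exact Function.LeftInverse.injective (g := ψ) fun p => DFunLike.congr_fun hid p

theorem isHomogeneous_coordinateMap {p : MvPolynomial (Fin r) k} {n : ℕ} (hp : p.IsHomogeneous n) :
    (coordinateMap y p).IsHomogeneous n := by
  simpa using hp.aeval _ (n := 1) fun i => (y i).2

theorem homogeneousComponent_coordinateMap (p : MvPolynomial (Fin r) k) (n : ℕ) :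
    homogeneousComponent n (coordinateMap y p) = coordinateMap y (homogeneousComponent n p) := by
  conv_lhs => rw [← sum_homogeneousComponent p, map_sum, map_sum]
  rw [Finset.sum_congr rfl fun i _ => homogeneousComponent_of_mem
    (isHomogeneous_coordinateMap y (homogeneousComponent_isHomogeneous i p))]
  rw [Finset.sum_ite_eq]
  split_ifs with h
  · rfl
  · rw [homogeneousComponent_eq_zero, map_zero]
    simpa using h

/-- If the variables are listed by `π` in such a way that all variables smaller than `X_{π t}` come
after position `t`, then a quadric with pivot `π t` lies in the `t`-th flag space of the reordered
basis. -/
theorem coordinateMap_mem_flagSpace {ord : MonomialOrder (Fin r)}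
    {J : Ideal (MvPolynomial (Fin r) k)} (π : Equiv.Perm (Fin r)) {t : Fin r}
    (hπ : ∀ a, ord.toSyn (Finsupp.single a 1) < ord.toSyn (Finsupp.single (π t) 1) →
      t < π.symm a) {Q : MvPolynomial (Fin r) k} (hQ : IsPivotQuadric ord J (π t) Q) :
    coordinateMap y Q ∈ flagSpace (y.reindex π.symm) t := by
  set x := y.reindex π.symm
  have hx (a : Fin r) : y a = x (π.symm a) := by simp [x]
  rw [Q.as_sum, map_sum]
  refine sum_mem fun d hd => ?_
  obtain ⟨a, b, rfl⟩ := exists_single_add_single_of_degree_eq_two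
    (hQ.isHomogeneous.degree_eq_sum_deg_support hd).symm
  have hmon : coordinateMap y (monomial (Finsupp.single a 1 + Finsupp.single b 1)
      (coeff (Finsupp.single a 1 + Finsupp.single b 1) Q)) =
      coeff (Finsupp.single a 1 + Finsupp.single b 1) Q •
        ((y a : MvPolynomial (Fin r) k) * y b) := by
    rw [← mul_one (coeff _ Q), ← smul_eq_mul, ← smul_monomial, map_smul, smul_eq_mul, mul_one,
      ← one_mul (1 : k), ← monomial_mul, map_mul]
    change _ • (coordinateMap y (X a) * coordinateMap y (X b)) = _
    rw [aeval_X, aeval_X]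
  rw [hmon]
  refine Submodule.smul_mem _ _ ?_
  rcases hQ.eq_or_lt hd with ⟨rfl, rfl⟩ | h | h
  · rw [hx, Equiv.symm_apply_apply]
    exact sq_mem_flagSpace x t
  · rw [hx a]
    exact mul_mem_flagSpace x (hπ a h) (y b)
  · rw [mul_comm, hx b]
    exact mul_mem_flagSpace x (hπ b h) (y a)

/-- If every nonzero element of the ideal involves a variable from `D`, the polynomial ring in the
remaining variables embeds in the quotient. -/
theorem card_compl_le_ringKrullDim {I : Ideal (MvPolynomial (Fin r) k)} (D : Finset (Fin r))
    (hD : ∀ p ∈ inCoordinates y I, p ≠ 0 → ∃ i ∈ p.vars, i ∈ D) :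
    ((Dᶜ.card : ℕ) : WithBot ℕ∞) ≤ ringKrullDim (MvPolynomial (Fin r) k ⧸ I) := by
  have h := natCard_le_ringKrullDim_of_injective (ι := {i // i ∈ Dᶜ})
    (((Ideal.Quotient.mkₐ k I).comp (coordinateMap y)).comp (rename Subtype.val)) ?_
  · rwa [Nat.card_eq_fintype_card, Fintype.card_coe] at h
  rw [injective_iff_map_eq_zero]
  intro p hp
  by_contra hp0
  have hmem : rename Subtype.val p ∈ inCoordinates y I := by
    change coordinateMap y (rename Subtype.val p) ∈ I
    exact Ideal.Quotient.eq_zero_iff_mem.mp hp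
  obtain ⟨i, hi, hiD⟩ := hD _ hmem
    ((map_ne_zero_iff _ (rename_injective _ Subtype.val_injective)).mpr hp0)
  classical
  obtain ⟨j, -, rfl⟩ := Finset.mem_image.mp (vars_rename Subtype.val p hi)
  exact Finset.mem_compl.mp j.2 hiD

end Coordinates

/-- The indices can be listed so that the first `e` of them belong to `D` and, at these positions,
everything of smaller `v`-value comes later: put `D` first, and sort by decreasing `v`. -/
theorem exists_perm_of_le_card {r e : ℕ} {α : Type*} [LinearOrder α] (v : Fin r → α)
    (D : Finset (Fin r)) (he : e ≤ D.card) :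
    ∃ π : Equiv.Perm (Fin r), ∀ t : Fin r, (t : ℕ) < e →
      π t ∈ D ∧ ∀ a, v a < v (π t) → t < π.symm a := by
  let f : Fin r → ℕ ×ₗ αᵒᵈ := fun i => toLex (if i ∈ D then 0 else 1, OrderDual.toDual (v i))
  have hmono : Monotone (f ∘ Tuple.sort f) := Tuple.monotone_sort f
  refine ⟨Tuple.sort f, fun t ht => ?_⟩
  have htD : Tuple.sort f t ∈ D := by
    by_contra htD
    have hsub : D ⊆ (Finset.Iio t).image (Tuple.sort f) := by
      intro i hi
      refine Finset.mem_image.mpr ⟨(Tuple.sort f).symm i, Finset.mem_Iio.mpr ?_, by simp⟩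
      by_contra! hle
      have := hmono hle
      simp [f, Prod.Lex.le_iff, hi, htD] at this
    have := (Finset.card_le_card hsub).trans Finset.card_image_le
    rw [Fin.card_Iio] at this
    omega
  refine ⟨htD, fun a ha => ?_⟩
  by_contra! hle
  have := hmono hle
  simp only [f, Function.comp_apply, Equiv.apply_symm_apply, Prod.Lex.le_iff, ofLex_toLex, htD,
    if_true] at this
  rcases this with h | ⟨-, h⟩
  · simp at h
  · exact absurd ha (not_lt.mpr (OrderDual.toDual_le_toDual.mp h))

end QuadraticInitial

theorem mainTheorem6 {k : Type*} [Field k] (r n e : ℕ)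
    (I : Ideal (MvPolynomial (Fin r) k))
    (hI : I.IsHomogeneous (MvPolynomial.homogeneousSubmodule (Fin r) k))
    (hn : ringKrullDim (MvPolynomial (Fin r) k ⧸ I) = (n : WithBot ℕ∞))
    (he : r = e + n)
    (y : Module.Basis (Fin r) k (QuadraticInitial.LinearForms k r))
    (ord : MonomialOrder (Fin r))
    (hquad : QuadraticInitial.IsGeneratedByQuadrics
      (QuadraticInitial.initialIdeal ord (QuadraticInitial.inCoordinates y I))) :
    (∃ (x : Module.Basis (Fin r) k (QuadraticInitial.LinearForms k r)) (c : Fin e → k)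
      (L : Fin e → Fin r → QuadraticInitial.LinearForms k r),
      (∀ i : Fin e,
        QuadraticInitial.flagQuadric x (Fin.castLE (by omega) i) (c i) (L i) ∈ I) ∧
      LinearIndependent k (fun i : Fin e =>
        QuadraticInitial.flagQuadric x (Fin.castLE (by omega) i) (c i) (L i))) ∧
    (∀ m : ℕ, 1 ≤ m → (m : ℕ∞) ≤ I.height →
      ∃ V : Submodule k (MvPolynomial (Fin r) k),
        V ≤ I.restrictScalars k ∧ Module.finrank k V = m ∧
        ∀ Q ∈ V, QuadraticInitial.IsQuadricOfRankLE Q (2 * (n + m) - 1)) := by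
  open QuadraticInitial MvPolynomial in
  classical
  set J := inCoordinates y I
  obtain ⟨G, hG, hspan⟩ := hquad
  have hJ : ∀ p ∈ J, homogeneousComponent 2 p ∈ J := by
    intro p hp
    change coordinateMap y _ ∈ I
    rw [← homogeneousComponent_coordinateMap]
    exact homogeneousComponent_mem_of_mem hI hp 2
  set D : Finset (Fin r) := Finset.univ.filter fun i => ∃ Q, IsPivotQuadric ord J i Q with hD
  -- `D` is the set of pivots; the variables outside `D` are independent modulo `I`.
  have hcompl : Dᶜ.card ≤ n := by
    have := card_compl_le_ringKrullDim y (I := I) D fun p hp hp0 => by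
      obtain ⟨i, hi, hQ⟩ := exists_isPivotQuadric_of_mem hJ hG hspan hp hp0
      exact ⟨i, hi, by simpa [hD] using hQ⟩
    rw [hn] at this
    exact_mod_cast this
  have heD : e ≤ D.card := by
    rw [Finset.card_compl, Fintype.card_fin] at hcompl
    omega
  obtain ⟨π, hπ⟩ := exists_perm_of_le_card (fun i => ord.toSyn (Finsupp.single i 1)) D heD
  have her : e ≤ r := by omega
  have hpivot (i : Fin e) : ∃ Q, IsPivotQuadric ord J (π (Fin.castLE her i)) Q := by
    simpa [hD] using (hπ (Fin.castLE her i) i.2).1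
  choose Q hQ using hpivot
  have hflag (i : Fin e) :
      coordinateMap y (Q i) ∈ flagSpace (y.reindex π.symm) (Fin.castLE her i) :=
    coordinateMap_mem_flagSpace y π (hπ _ i.2).2 (hQ i)
  have hind : LinearIndependent k fun i => coordinateMap y (Q i) := by
    refine LinearIndependent.map' ?_ (coordinateMap y).toLinearMap
      (LinearMap.ker_eq_bot.mpr (coordinateMap_injective y))
    exact linearIndependent_of_isPivotQuadric (π.injective.comp (Fin.castLE_injective her)) hQ
  refine ⟨?_, fun m hm1 hm => ?_⟩
  · choose c L hcL using hflag
    refine ⟨y.reindex π.symm, c, L, fun i => ?_, ?_⟩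
    · rw [← hcL]
      exact (hQ i).mem
    · simpa only [← hcL] using hind
  · have hme : m ≤ e := by
      have h := height_add_ringKrullDim_quotient_le I
      rw [hn, MvPolynomial.ringKrullDim_of_isNoetherianRing, ringKrullDim_eq_zero_of_field,
        Nat.card_fin, zero_add] at h
      have h' : ((m : ℕ∞) : WithBot ℕ∞) + n ≤ r :=
        le_trans (add_le_add_left (WithBot.coe_le_coe.mpr hm) _) h
      have h'' : m + n ≤ r := by exact_mod_cast h'
      omega
    -- The last `m` of the `e` quadrics lie in the flag space at position `e - m`, after which
    -- `n + m - 1` positions remain.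
    let τ : Fin m → Fin e := fun j => ⟨e - m + j, by omega⟩
    have hτ : Function.Injective τ := fun a b hab => by
      simp only [τ, Fin.mk.injEq] at hab
      omega
    refine ⟨Submodule.span k (Set.range fun j => coordinateMap y (Q (τ j))), ?_, ?_, ?_⟩
    · rw [Submodule.span_le]
      rintro _ ⟨j, rfl⟩
      exact (hQ (τ j)).mem
    · exact (finrank_span_eq_card (hind.comp τ hτ)).trans (Fintype.card_fin m)
    · intro q hq
      have hle : Submodule.span k (Set.range fun j => coordinateMap y (Q (τ j))) ≤
          flagSpace (y.reindex π.symm) ⟨e - m, by omega⟩ := by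
        rw [Submodule.span_le]
        rintro _ ⟨j, rfl⟩
        exact flagSpace_antitone _ (Fin.mk_le_mk.mpr (by simp [τ])) (hflag (τ j))
      exact isQuadricOfRankLE_of_mem_flagSpace _ (hle hq) (by dsimp only; omega)
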